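/- Let $k$ be an algebraically closed field and let $q,n\ge 1$ be integers. Put $A_{q,n}=k[x_1,\dots,x_q]/\langle x_1,\dots,x_q\rangle^n$, with maximal ideal $\mathfrak m=\langle x_1,\dots,x_q\rangle$, and let $\mathrm{GA}_{q,n}$ be the group of $k$-algebra automorphisms of $A_{q,n}$, a closed subgroup of $\mathrm{GL}(A_{q,n})$. Let $\mathcal I_{q,n}\subseteq \mathrm{GA}_{q,n}$ be the (closed) kernel of the natural action on $\mathfrak m/\mathfrak m^2$, and let $G_1\subseteq\mathrm{GA}_{q,n}$ be the stabilizer of the ideal $\mathfrak q_1=\langle x_2,\dots,x_q\rangle$. Let $\Omega_1\subseteq A_{q,n}$ be the $k$-subspace spanned by $x_2,\dots,x_q$, let $z^2k[z]/z^n$ denote the ideal generated by $z^2$ in $k[z]/\langle z^n\rangle$, and let $$\Gamma=\{\sigma\in \mathrm{GA}_{q,n} : \sigma(x_1)=x_1,\ \sigma(x_i)=x_i+x_1^2f_i(x_1)\text{ with } f_i\in k[t],\ i\ge 2\}.$$ Then there is an isomorphism of varieties $$\psi:\ \mathcal I_{q,n}/(\mathcal I_{q,n}\cap G_1)\ \longrightarrow\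 \operatorname{Hom}_k(\Omega_1,\, z^2k[z]/z^n),$$ where the left side is the homogeneous space of left cosets (with the quotient variety structure) and the right side is a finite-dimensional vector space regarded as an affine space, which is of dimension $(q-1)(n-2)$ if $n\ge 2$. The isomorphism $\psi$ is natural in the following sense. Every $g\in\mathcal I_{q,n}$ can be written uniquely as $g=\sigma\tau$ with $\sigma\in\Gamma$ and $\tau\in\mathcal I_{q,n}\cap G_1$, and $\psi$ sends the coset of $g$ to the homomorphism $h$ that corresponds to $\sigma$, that is, $\sigma(u)=u+h(u)(x_1)$ for all $u\in\Omega_1$, where $h(u)(x_1)\in A_{q,n}$ is obtained from $h(u)$ by substituting $x_1$ for $z$. For this $h$, the ideal $g(\mathfrak q_1)$ is generated by the elements $u+h(u)(x_1)$, $u\in\Omega_1$. -/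

import Mathlib

open scoped Topology

noncomputable section

namespace NilAut

/-! ## Spaces with functions: varieties over a field in the classical sense -/

/-- A space with functions over `k` on the set `X`: a topology together with, for each open set `U`,
a class of regular functions on `U`. A function on `U` is represented by any
extension of it to all of `X`; by `congr` only its values on `U` matter. Regular functions on open
sets form a sheaf of `k`-algebras of `k`-valued functions. Only open sets `U` are meaningful. -/
structure FunSpace (k : Type*) [Field k] (X : Type*) where
  top : TopologicalSpace X
  RegularOn : Set X → (X → k) → Prop
  congr : ∀ {U : Set X} {f g : X → k}, IsOpen[top] U → Set.EqOn f g U →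
    RegularOn U f → RegularOn U g
  const : ∀ {U : Set X} (c : k), IsOpen[top] U → RegularOn U (fun _ => c)
  add : ∀ {U : Set X} {f g : X → k}, IsOpen[top] U → RegularOn U f → RegularOn U g →
    RegularOn U (f + g)
  mul : ∀ {U : Set X} {f g : X → k}, IsOpen[top] U → RegularOn U f → RegularOn U g →
    RegularOn U (f * g)
  mono : ∀ {U V : Set X} {f : X → k}, IsOpen[top] U → IsOpen[top] V → V ⊆ U →
    RegularOn U f → RegularOn V f
  glue : ∀ {U : Set X} {f : X → k}, IsOpen[top] U →
    (∀ x ∈ U, ∃ V : Set X, IsOpen[top] V ∧ x ∈ V ∧ V ⊆ U ∧ RegularOn V f) → RegularOn U f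

/-- A morphism of spaces with functions: a continuous map that pulls regular functions back to
regular functions. -/
structure IsMorphism {k : Type*} [Field k] {X Y : Type*} (S : FunSpace k X) (T : FunSpace k Y)
    (φ : X → Y) : Prop where
  isOpen_preimage : ∀ U : Set Y, IsOpen[T.top] U → IsOpen[S.top] (φ ⁻¹' U)
  regularOn_comp : ∀ (U : Set Y) (f : Y → k), IsOpen[T.top] U → T.RegularOn U f →
    S.RegularOn (φ ⁻¹' U) (f ∘ φ)

/-- An isomorphism of spaces with functions (in particular, of varieties). -/
structure IsIsomorphism {k : Type*} [Field k] {X Y : Type*} (S : FunSpace k X) (T : FunSpace k Y)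
    (e : X ≃ Y) : Prop where
  isMorphism : IsMorphism S T e
  isMorphism_symm : IsMorphism T S e.symm

/-- The algebra of polynomial functions on a vector space `V`: the algebra of functions generated
by the linear forms. -/
def polyFun (k : Type*) [Field k] (V : Type*) [AddCommGroup V] [Module k V] :
    Subalgebra k (V → k) :=
  Algebra.adjoin k (Set.range fun (l : Module.Dual k V) (v : V) => l v)

/-- The Zariski topology on a vector space: the nonvanishing sets of polynomial
functions form a basis (they are closed under finite intersections). -/
@[reducible] def zariski (k : Type*) [Field k] (V : Type*) [AddCommGroup V] [Module k V] :
    TopologicalSpace V :=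
  TopologicalSpace.generateFrom {U | ∃ p ∈ polyFun k V, U = {v | p v ≠ 0}}

/-- The structure of a subvariety on `X`, for an injection `i` of `X` onto a locally closed subset
of a finite-dimensional vector space `V`: the induced Zariski topology, and as regular functions
the functions which locally are quotients of polynomial functions. -/
def subvariety (k : Type*) [Field k] {V : Type*} [AddCommGroup V] [Module k V] {X : Type*}
    (i : X → V) : FunSpace k X where
  top := (zariski k V).induced i
  RegularOn U f := ∀ x ∈ U, ∃ W : Set X, IsOpen[(zariski k V).induced i] W ∧ x ∈ W ∧
    ∃ p ∈ polyFun k V, ∃ r ∈ polyFun k V, ∀ y ∈ W ∩ U, r (i y) ≠ 0 ∧ f y = p (i y) / r (i y)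
  congr := by
    intro U f g _ h hf x hx
    obtain ⟨W, hW, hxW, p, hp, r, hr, H⟩ := hf x hx
    exact ⟨W, hW, hxW, p, hp, r, hr, fun y hy => ⟨(H y hy).1, (h hy.2) ▸ (H y hy).2⟩⟩
  const := by
    intro U c _ x hx
    exact ⟨Set.univ, @isOpen_univ _ ((zariski k V).induced i), trivial,
      algebraMap k (V → k) c, Subalgebra.algebraMap_mem _ c, 1, Subalgebra.one_mem _,
      fun y _ => by simp⟩
  add := by
    intro U f g _ hf hg x hx
    obtain ⟨W, hW, hxW, p, hp, r, hr, H⟩ := hf x hx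
    obtain ⟨W', hW', hxW', p', hp', r', hr', H'⟩ := hg x hx
    refine ⟨W ∩ W', @IsOpen.inter _ ((zariski k V).induced i) _ _ hW hW', ⟨hxW, hxW'⟩,
      p * r' + r * p', Subalgebra.add_mem _ (Subalgebra.mul_mem _ hp hr')
        (Subalgebra.mul_mem _ hr hp'), r * r', Subalgebra.mul_mem _ hr hr', fun y hy => ?_⟩
    obtain ⟨h1, h2⟩ := H y ⟨hy.1.1, hy.2⟩
    obtain ⟨h1', h2'⟩ := H' y ⟨hy.1.2, hy.2⟩
    refine ⟨mul_ne_zero h1 h1', ?_⟩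
    simp only [Pi.add_apply, Pi.mul_apply, h2, h2']
    exact div_add_div _ _ h1 h1'
  mul := by
    intro U f g _ hf hg x hx
    obtain ⟨W, hW, hxW, p, hp, r, hr, H⟩ := hf x hx
    obtain ⟨W', hW', hxW', p', hp', r', hr', H'⟩ := hg x hx
    refine ⟨W ∩ W', @IsOpen.inter _ ((zariski k V).induced i) _ _ hW hW', ⟨hxW, hxW'⟩,
      p * p', Subalgebra.mul_mem _ hp hp', r * r', Subalgebra.mul_mem _ hr hr', fun y hy => ?_⟩
    obtain ⟨h1, h2⟩ := H y ⟨hy.1.1, hy.2⟩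
    obtain ⟨h1', h2'⟩ := H' y ⟨hy.1.2, hy.2⟩
    refine ⟨mul_ne_zero h1 h1', ?_⟩
    simp only [Pi.mul_apply, h2, h2']
    exact div_mul_div_comm _ _ _ _
  mono := by
    intro U V' f _ _ h hf x hx
    obtain ⟨W, hW, hxW, p, hp, r, hr, H⟩ := hf x (h hx)
    exact ⟨W, hW, hxW, p, hp, r, hr, fun y hy => H y ⟨hy.1, h hy.2⟩⟩
  glue := by
    intro U f _ h x hx
    obtain ⟨V', hV', hxV', hsub, hf⟩ := h x hx
    obtain ⟨W, hW, hxW, p, hp, r, hr, H⟩ := hf x hxV'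
    exact ⟨W ∩ V', @IsOpen.inter _ ((zariski k V).induced i) _ _ hW hV', ⟨hxW, hxV'⟩, p, hp, r,
      hr, fun y hy => H y hy.1⟩

/-- A finite-dimensional vector space as a variety (an affine space). -/
def affineSpace (k : Type*) [Field k] (V : Type*) [AddCommGroup V] [Module k V] : FunSpace k V :=
  subvariety k (id : V → V)

/-- The quotient structure along a map `π`: the quotient topology, and a function on `U` is
regular when its composite with `π` is regular on the preimage of `U`. For an algebraic
group modulo a closed subgroup this is the variety structure of the homogeneous space. -/
def quotientSpace {k : Type*} [Field k] {X Y : Type*} (S : FunSpace k X) (π : X → Y) :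
    FunSpace k Y where
  top := S.top.coinduced π
  RegularOn U f := S.RegularOn (π ⁻¹' U) (f ∘ π)
  congr := fun hU h hf => S.congr hU (fun _ hx => h hx) hf
  const := fun c hU => S.const c hU
  add := fun hU hf hg => S.add hU hf hg
  mul := fun hU hf hg => S.mul hU hf hg
  mono := fun hU hV h hf => S.mono hU hV (Set.preimage_mono h) hf
  glue := by
    intro U f hU h
    refine S.glue hU fun x hx => ?_
    obtain ⟨V, hV, hxV, hsub, hf⟩ := h (π x) hx
    exact ⟨π ⁻¹' V, hV, hxV, Set.preimage_mono hsub, hf⟩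

/-! ## The ring of `n`-nil polynomials and its automorphisms -/

section

variable (k : Type*) [Field k] (q n : ℕ)

/-- `A_{q,n} = k[x_1, …, x_q] / (x_1, …, x_q)^n`, with variables indexed from `0`. -/
abbrev A : Type _ := MvPolynomial (Fin q) k ⧸ (MvPolynomial.idealOfVars (Fin q) k) ^ n

/-- The class of the `i`-th variable in `A_{q,n}`. -/
def var (i : Fin q) : A k q n := Ideal.Quotient.mk _ (MvPolynomial.X i)

/-- The ideal `𝔪` of `A_{q,n}` generated by all the variables. -/
def m : Ideal (A k q n) :=
  (MvPolynomial.idealOfVars (Fin q) k).map (Ideal.Quotient.mk _)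

/-- The group `GA_{q,n}` of `k`-algebra automorphisms of `A_{q,n}` (product is composition). -/
abbrev GA : Type _ := A k q n ≃ₐ[k] A k q n

variable {k q n}

lemma mk_mem_m_iff (hn : n ≠ 0) (p : MvPolynomial (Fin q) k) :
    (Ideal.Quotient.mk _ p : A k q n) ∈ m k q n ↔ MvPolynomial.constantCoeff p = 0 := by
  have hle : (MvPolynomial.idealOfVars (Fin q) k) ^ n ≤ MvPolynomial.idealOfVars (Fin q) k :=
    Ideal.pow_le_self hn
  rw [m, Ideal.mem_quotient_iff_mem hle, ← pow_one (MvPolynomial.idealOfVars (Fin q) k),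
    MvPolynomial.mem_pow_idealOfVars_iff', MvPolynomial.constantCoeff_eq]
  constructor
  · intro h
    exact h 0 (by simp)
  · intro h x hx
    have : x = 0 := by
      rw [← Finsupp.degree_eq_zero_iff]
      omega
    rw [this, h]

lemma pow_eq_zero_of_mem_m {a : A k q n} (ha : a ∈ m k q n) : a ^ n = 0 := by
  have h : a ^ n ∈ (m k q n) ^ n := Ideal.pow_mem_pow ha n
  rw [m, ← Ideal.map_pow, Ideal.map_quotient_self] at h
  simpa using h

lemma var_mem_m (i : Fin q) : var k q n i ∈ m k q n :=
  Ideal.mem_map_of_mem _ (Ideal.subset_span ⟨i, rfl⟩)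

lemma var_pow (i : Fin q) : var k q n i ^ n = 0 := pow_eq_zero_of_mem_m (var_mem_m i)

/-- Every automorphism preserves `𝔪`. -/
lemma m_le_comap (σ : GA k q n) : m k q n ≤ (m k q n).comap σ.toAlgHom := by
  intro a ha
  rw [Ideal.mem_comap]
  rcases eq_or_ne n 0 with rfl | hn
  · have : (1 : A k q 0) = 0 := by simpa using pow_eq_zero_of_mem_m ha
    have h0 : ∀ b : A k q 0, b = 0 := fun b => by rw [← mul_one b, this, mul_zero]
    rw [h0 (σ.toAlgHom a)]
    exact Ideal.zero_mem _
  · have h : (σ.toAlgHom a) ^ n = 0 := by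
      rw [← map_pow, pow_eq_zero_of_mem_m ha, map_zero]
    obtain ⟨p, hp⟩ := Ideal.Quotient.mk_surjective (σ.toAlgHom a)
    rw [← hp] at h ⊢
    rw [← map_pow] at h
    rw [mk_mem_m_iff hn]
    have h' := (mk_mem_m_iff (n := n) hn (p ^ n)).1 (h ▸ Ideal.zero_mem _)
    rw [map_pow] at h'
    exact pow_eq_zero_iff hn |>.1 h'

variable (k q n)

/-- The representation of `GA_{q,n}` on the cotangent space `𝔪/𝔪²`. -/
def cotangentRep : GA k q n →* LinearMap.GeneralLinearGroup k (m k q n).Cotangent :=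
  MonoidHom.toHomUnits
    { toFun := fun σ => Ideal.mapCotangent (m k q n) (m k q n) σ.toAlgHom (m_le_comap σ)
      map_one' := by
        refine LinearMap.ext fun x => ?_
        obtain ⟨y, rfl⟩ := Ideal.toCotangent_surjective _ x
        rfl
      map_mul' := fun σ τ => by
        refine LinearMap.ext fun x => ?_
        obtain ⟨y, rfl⟩ := Ideal.toCotangent_surjective _ x
        rfl }

/-- The group `I_{q,n}` of linearly trivial automorphisms. -/
def I : Subgroup (GA k q n) := (cotangentRep k q n).ker

/-- The linear automorphism of the vector space `A_{q,n}` underlying an element of `I_{q,n}`. -/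
def I.toEnd (g : I k q n) : Module.End k (A k q n) := (g : GA k q n).toLinearMap

/-- `I_{q,n}` as a subvariety of the space of linear endomorphisms of `A_{q,n}`, i.e.
as a closed subgroup of the algebraic group `GL(A_{q,n})`. -/
def I.variety : FunSpace k (I k q n) := subvariety k (I.toEnd k q n)

variable [NeZero q]

/-- The ideal `𝔮₁ = ⟨x_2, …, x_q⟩`. -/
def q₁ : Ideal (A k q n) := Ideal.span {a | ∃ i : Fin q, i ≠ 0 ∧ a = var k q n i}

/-- The stabilizer `G₁` of the ideal `𝔮₁` in `GA_{q,n}`: the automorphisms `σ` with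
`σ(𝔮₁) = 𝔮₁`. -/
def G₁ : Subgroup (GA k q n) where
  carrier := {σ | (q₁ k q n).map (σ : A k q n →+* A k q n) = q₁ k q n}
  one_mem' := Ideal.map_id _
  mul_mem' := by
    intro σ τ hσ hτ
    change Ideal.map (((σ : A k q n →+* A k q n)).comp (τ : A k q n →+* A k q n)) _ = _
    rw [← Ideal.map_map, hτ, hσ]
  inv_mem' := by
    intro σ hσ
    have h : ((σ⁻¹ : GA k q n) : A k q n →+* A k q n).comp (σ : A k q n →+* A k q n) =
        RingHom.id _ := RingHom.ext fun x => σ.symm_apply_apply x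
    change Ideal.map ((σ⁻¹ : GA k q n) : A k q n →+* A k q n) _ = _
    conv_lhs => rw [← hσ]
    rw [Ideal.map_map, h, Ideal.map_id]

/-- The set `I_{q,n} / (I_{q,n} ∩ G₁)` of left cosets. -/
abbrev Quot₁ : Type _ := I k q n ⧸ (I k q n ⊓ G₁ k q n).subgroupOf (I k q n)

/-- The homogeneous space `I_{q,n} / (I_{q,n} ∩ G₁)` as a variety. -/
def Quot₁.variety : FunSpace k (Quot₁ k q n) :=
  quotientSpace (I.variety k q n) (fun g => (g : Quot₁ k q n))

/-- The subspace `Ω₁` of `A_{q,n}` spanned by `x_2, …, x_q`. -/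
def Ω₁ : Submodule k (A k q n) := Submodule.span k {a | ∃ i : Fin q, i ≠ 0 ∧ a = var k q n i}

/-- The truncated polynomial ring `k[z]/z^n`. -/
abbrev TruncPoly (k : Type*) [Field k] (n : ℕ) : Type _ :=
  Polynomial k ⧸ Ideal.span {(Polynomial.X : Polynomial k) ^ n}

/-- The subspace `z² k[z]/z^n` of `k[z]/z^n`. -/
def zSq (k : Type*) [Field k] (n : ℕ) : Submodule k (TruncPoly k n) :=
  (Ideal.span {(Ideal.Quotient.mk _ Polynomial.X : TruncPoly k n) ^ 2}).restrictScalars k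

/-- The substitution `f(z) ↦ f(x_1)` from `k[z]/z^n` to `A_{q,n}`. -/
def subst : TruncPoly k n →ₐ[k] A k q n :=
  Ideal.Quotient.liftₐ _ (Polynomial.aeval (var k q n 0)) (by
    intro a ha
    obtain ⟨b, rfl⟩ := Ideal.mem_span_singleton.1 ha
    simp [var_pow])

/-- The automorphisms `σ` with `σ(x_1) = x_1` and `σ(x_i) = x_i + x_1² f_i(x_1)` for `i ≥ 2`. -/
def Γ : Set (GA k q n) :=
  {σ | σ (var k q n 0) = var k q n 0 ∧ ∀ i : Fin q, i ≠ 0 → ∃ f : Polynomial k,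
    σ (var k q n i) = var k q n i + var k q n 0 ^ 2 * Polynomial.aeval (var k q n 0) f}

/-- The space `Hom_k(Ω₁, z² k[z]/z^n)`. -/
abbrev HomSpace : Type _ := Ω₁ k q n →ₗ[k] zSq k n

end

end NilAut

end

/-! Let ρ : A → k[z]/z^n send x_1 to z and the other variables to 0. Its kernel is 𝔮₁, and ι : f(z)
↦ f(x_1) is a section of it. Each h in Hom(Ω₁, z²k[z]/z^n) defines a shear x_1 ↦ x_1, u ↦ u +
h(u)(x_1). Shears fix all polynomials in x_1, so composing them adds the h's, and Γ is exactly the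
set of shears.

Given g in I, a factorization g = shear(h)τ has τ in G₁ iff ρ ∘ g⁻¹ ∘ shear(h) kills 𝔮₁. On Ω₁ this
says ρ(g⁻¹u) + φ(h(u)) = 0 with φ = ρ ∘ g⁻¹ ∘ ι. Since φ ≡ id mod z², it is an automorphism of
k[z]/z^n, so h = -φ⁻¹ρg⁻¹ is the only solution (`shear_coord_inv_mul_mem`, `eq_of_shear_mul_eq`).

Both g and φ are unipotent, so their inverses are truncated geometric series. Hence g ↦ h is the
restriction of a polynomial map on End(A) (`exists_isPolyMap_coord`). It is constant exactly on the
cosets and has the polynomial section h ↦ shear(h) (`isPolyMap_shear`), so it identifies the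
quotient structure with the affine space. -/

namespace NilAut

/-! ### Polynomial maps between vector spaces -/

section PolyMap

variable {k : Type*} [Field k]
variable {U V W X : Type*} [AddCommGroup U] [Module k U] [AddCommGroup V] [Module k V]
  [AddCommGroup W] [Module k W] [AddCommGroup X] [Module k X]

/-- A polynomial map of vector spaces: linear forms pull back to polynomial functions. -/
def IsPolyMap (k : Type*) [Field k] {V W : Type*} [AddCommGroup V] [Module k V]
    [AddCommGroup W] [Module k W] (F : V → W) : Prop :=
  ∀ l : Module.Dual k W, (fun v => l (F v)) ∈ polyFun k V

namespace IsPolyMap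

lemma comp_mem {F : V → W} (hF : IsPolyMap k F) {p : W → k} (hp : p ∈ polyFun k W) :
    (fun v => p (F v)) ∈ polyFun k V := by
  induction hp using Algebra.adjoin_induction with
  | mem x hx => obtain ⟨l, rfl⟩ := hx; exact hF l
  | algebraMap r => exact Subalgebra.algebraMap_mem _ r
  | add x y _ _ hx hy => exact Subalgebra.add_mem _ hx hy
  | mul x y _ _ hx hy => exact Subalgebra.mul_mem _ hx hy

lemma const (w : W) : IsPolyMap k (fun _ : V => w) := fun l =>
  Subalgebra.algebraMap_mem (polyFun k V) (l w)

lemma linear (f : V →ₗ[k] W) : IsPolyMap k f := fun l =>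
  Algebra.subset_adjoin ⟨l ∘ₗ f, rfl⟩

lemma linear_comp {F : V → W} (hF : IsPolyMap k F) (f : W →ₗ[k] X) :
    IsPolyMap k (fun v => f (F v)) := fun l => hF (l ∘ₗ f)

lemma add {F G : V → W} (hF : IsPolyMap k F) (hG : IsPolyMap k G) :
    IsPolyMap k (fun v => F v + G v) := fun l => by
  simp only [map_add]
  exact Subalgebra.add_mem _ (hF l) (hG l)

lemma sub {F G : V → W} (hF : IsPolyMap k F) (hG : IsPolyMap k G) :
    IsPolyMap k (fun v => F v - G v) := fun l => by
  simp only [map_sub]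
  exact Subalgebra.sub_mem _ (hF l) (hG l)

lemma sum {ι : Type*} (s : Finset ι) {F : ι → V → W} (hF : ∀ i ∈ s, IsPolyMap k (F i)) :
    IsPolyMap k (fun v => ∑ i ∈ s, F i v) := fun l => by
  have := Subalgebra.sum_mem (polyFun k V) (fun i hi => hF i hi l)
  convert this using 1
  ext v
  simp

/-- Expanding the first argument in a basis leaves products of coordinates of F with linear
functions of G. -/
lemma bilin [FiniteDimensional k W] (b : W →ₗ[k] X →ₗ[k] U) {F : V → W} {G : V → X}
    (hF : IsPolyMap k F) (hG : IsPolyMap k G) : IsPolyMap k (fun v => b (F v) (G v)) := by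
  let e := Module.finBasis k W
  have h : (fun v => b (F v) (G v)) = fun v => ∑ i, e.coord i (F v) • b (e i) (G v) := by
    ext v
    conv_lhs => rw [← e.sum_repr (F v), map_sum]
    simp only [map_smul, LinearMap.sum_apply, LinearMap.smul_apply, Module.Basis.coord_apply]
  rw [h]
  refine sum _ fun i _ l => ?_
  have := Subalgebra.mul_mem _ (hF (e.coord i)) (hG (l ∘ₗ b (e i)))
  convert this using 1
  ext v
  simp

lemma mul {B : Type*} [Ring B] [Algebra k B] [FiniteDimensional k B] {F G : V → B}
    (hF : IsPolyMap k F) (hG : IsPolyMap k G) : IsPolyMap k (fun v => F v * G v) :=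
  bilin (LinearMap.mul k B) hF hG

lemma pow {B : Type*} [Ring B] [Algebra k B] [FiniteDimensional k B] {F : V → B}
    (hF : IsPolyMap k F) (j : ℕ) : IsPolyMap k (fun v => F v ^ j) := by
  induction j with
  | zero => simpa using const (1 : B)
  | succ j ih => simpa only [pow_succ] using ih.mul hF

/-- The truncated geometric series `∑ (1 - F)^j`, the inverse of a unipotent `F`. -/
lemma geom_sum {B : Type*} [Ring B] [Algebra k B] [FiniteDimensional k B] {F : V → B}
    (hF : IsPolyMap k F) (n : ℕ) :
    IsPolyMap k (fun v => ∑ j ∈ Finset.range n, (1 - F v) ^ j) :=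
  sum _ fun j _ => ((const 1).sub hF).pow j

lemma of_apply [FiniteDimensional k W] {F : V → W →ₗ[k] X}
    (hF : ∀ w, IsPolyMap k (fun v => F v w)) : IsPolyMap k F := by
  let e := Module.finBasis k W
  have h : F = fun v => ∑ i, LinearMap.smulRightₗ (e.coord i) (F v (e i)) := by
    ext v w
    conv_lhs => rw [← e.sum_repr w, map_sum]
    simp only [map_smul, LinearMap.sum_apply, LinearMap.smulRightₗ_apply,
      LinearMap.smulRight_apply,
      Module.Basis.coord_apply]
  rw [h]
  exact sum _ fun i _ => (hF (e i)).linear_comp (LinearMap.smulRightₗ (e.coord i))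

/-- The inverse of a unipotent `M`, compressed by `ρ` and `ι` and inverted again as a unipotent
endomorphism, depends polynomially on `M`. -/
lemma compressed_inverse [FiniteDimensional k V] [FiniteDimensional k W] (ρ : V →ₗ[k] W)
    (ι : W →ₗ[k] V) (j : U →ₗ[k] V) (r : W →ₗ[k] X) (n : ℕ) :
    IsPolyMap k (fun M : Module.End k V => r ∘ₗ
      (∑ a ∈ Finset.range n,
        (1 - (ρ ∘ₗ (∑ b ∈ Finset.range n, (1 - M) ^ b) ∘ₗ ι : Module.End k W)) ^ a) ∘ₗ
      ρ ∘ₗ (∑ b ∈ Finset.range n, (1 - M) ^ b) ∘ₗ j) := by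
  have hinv : IsPolyMap k fun M : Module.End k V => ∑ b ∈ Finset.range n, (1 - M) ^ b :=
    (linear LinearMap.id).geom_sum n
  have hS : IsPolyMap k fun M : Module.End k V =>
      (ρ ∘ₗ (∑ b ∈ Finset.range n, (1 - M) ^ b) ∘ₗ ι : Module.End k W) :=
    hinv.linear_comp (LinearMap.compRight k ρ ∘ₗ LinearMap.lcomp k V ι)
  have hR : IsPolyMap k fun M : Module.End k V =>
      ρ ∘ₗ (∑ b ∈ Finset.range n, (1 - M) ^ b) ∘ₗ j :=
    hinv.linear_comp (LinearMap.compRight k ρ ∘ₗ LinearMap.lcomp k V j)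
  exact (bilin (LinearMap.llcomp k U W W) (hS.geom_sum n) hR).linear_comp (LinearMap.compRight k r)

/-- A map of subvarieties induced by a polynomial map of the ambient spaces is a morphism. -/
lemma isMorphism {Y Z : Type*} {i : Y → V} {j : Z → W} {φ : Y → Z} {F : V → W}
    (hF : IsPolyMap k F) (h : ∀ y, j (φ y) = F (i y)) :
    IsMorphism (subvariety k i) (subvariety k j) φ := by
  have hF' : @Continuous _ _ (zariski k V) (zariski k W) F :=
    (@continuous_generateFrom_iff _ _ _ (zariski k V) _).2 <| by
      rintro _ ⟨p, hp, rfl⟩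
      exact TopologicalSpace.isOpen_generateFrom_of_mem ⟨_, hF.comp_mem hp, rfl⟩
  have hcont : @Continuous _ _ ((zariski k V).induced i) ((zariski k W).induced j) φ := by
    refine (@continuous_induced_rng _ _ _ _ _ (zariski k W) ((zariski k V).induced i)).2 ?_
    rw [show j ∘ φ = F ∘ i from funext h]
    exact @Continuous.comp _ _ _ ((zariski k V).induced i) (zariski k V) (zariski k W) _ _ hF'
      (@continuous_induced_dom _ _ i (zariski k V))
  have hopen := @Continuous.isOpen_preimage _ _ ((zariski k V).induced i)
    ((zariski k W).induced j) _ hcont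
  refine ⟨fun U hU => hopen U hU, fun U f _ hf x hx => ?_⟩
  obtain ⟨N, hN, hxN, p, hp, r, hr, H⟩ := hf (φ x) hx
  refine ⟨φ ⁻¹' N, hopen N hN, hxN, _, hF.comp_mem hp, _, hF.comp_mem hr,
    fun y hy => ?_⟩
  simpa only [h, Function.comp_apply] using H (φ y) hy

end IsPolyMap

end PolyMap

end NilAut

namespace NilAut

/-! ### Algebra endomorphisms congruent to the identity modulo J² -/

section Unipotent

variable {k : Type*} [Field k] {B : Type*} [CommRing B] [Algebra k B]

/-- The twisted Leibniz rule φ(ba) - ba = φ(b)(φ(a) - a) + (φ(b) - b)a drives the induction: both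
terms gain one more power of J. -/
lemma map_sub_self_mem_pow {J : Ideal B} {φ : B →ₐ[k] B} (h : ∀ b, φ b - b ∈ J ^ 2) (j : ℕ) :
    ∀ b ∈ J ^ j, φ b - b ∈ J ^ (j + 1) := by
  induction j with
  | zero => exact fun b _ => Ideal.pow_le_pow_right (by norm_num) (h b)
  | succ j ih =>
    intro b hb
    rw [pow_succ] at hb
    induction hb using Submodule.mul_induction_on' with
    | mem_mul_mem b hb a ha =>
      have h1 : φ b ∈ J ^ j := by
        have := Ideal.add_mem _ (Ideal.pow_le_pow_right j.le_succ (ih b hb)) hb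
        simpa using this
      have h2 := Ideal.mul_mem_mul h1 (h a)
      have h3 := Ideal.mul_mem_mul (ih b hb) ha
      rw [← pow_add] at h2
      rw [← pow_succ] at h3
      rw [map_mul, show φ b * φ a - b * a = φ b * (φ a - a) + (φ b - b) * a by ring]
      exact Ideal.add_mem _ h2 h3
    | add x _ y _ hx hy =>
      rw [map_add, add_sub_add_comm]
      exact Ideal.add_mem _ hx hy

lemma one_sub_toLinearMap_pow_eq_zero {J : Ideal B} {n : ℕ} (hJ : J ^ n = ⊥) {φ : B →ₐ[k] B}
    (h : ∀ b, φ b - b ∈ J ^ 2) : (1 - φ.toLinearMap : Module.End k B) ^ n = 0 := by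
  have key : ∀ j b, ((1 - φ.toLinearMap : Module.End k B) ^ j) b ∈ J ^ j := by
    intro j
    induction j with
    | zero => simp
    | succ j ih =>
      intro b
      have := map_sub_self_mem_pow h j _ (ih b)
      rw [show ((1 - φ.toLinearMap : Module.End k B) ^ (j + 1)) b =
        -(φ (((1 - φ.toLinearMap : Module.End k B) ^ j) b) -
          ((1 - φ.toLinearMap : Module.End k B) ^ j) b) by
        rw [_root_.pow_succ' (1 - φ.toLinearMap : Module.End k B), Module.End.mul_apply]; simp]
      exact neg_mem this
  ext b
  have := key n b
  rw [hJ] at this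
  simpa using this

lemma bijective_of_map_sub_self_mem {J : Ideal B} {n : ℕ} (hJ : J ^ n = ⊥) {φ : B →ₐ[k] B}
    (h : ∀ b, φ b - b ∈ J ^ 2) : Function.Bijective φ := by
  have hN := one_sub_toLinearMap_pow_eq_zero hJ h
  have h1 := mul_neg_geom_sum (1 - φ.toLinearMap : Module.End k B) n
  have h2 := geom_sum_mul_neg (1 - φ.toLinearMap : Module.End k B) n
  rw [hN, sub_zero, sub_sub_cancel] at h1 h2
  refine Function.bijective_iff_has_inverse.2
    ⟨_, fun b => LinearMap.congr_fun h2 b, fun b => LinearMap.congr_fun h1 b⟩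

/-- As 1 - φ is nilpotent, the inverse is a polynomial expression in φ; this is the source of
algebraicity of inversion below. -/
lemma symm_toLinearMap_eq_geom_sum {J : Ideal B} {n : ℕ} (hJ : J ^ n = ⊥) {φ : B ≃ₐ[k] B}
    (h : ∀ b, φ b - b ∈ J ^ 2) : (φ.symm.toLinearMap : Module.End k B) =
      ∑ j ∈ Finset.range n, (1 - (φ.toLinearMap : Module.End k B)) ^ j := by
  have hN := one_sub_toLinearMap_pow_eq_zero (φ := φ.toAlgHom) hJ h
  have h1 := mul_neg_geom_sum (1 - φ.toLinearMap : Module.End k B) n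
  rw [show (1 - φ.toLinearMap : Module.End k B) ^ n = 0 from hN, sub_zero, sub_sub_cancel] at h1
  ext b
  have := LinearMap.congr_fun h1 b
  rw [AlgEquiv.toLinearMap_apply, AlgEquiv.symm_apply_eq]
  exact this.symm

end Unipotent

/-! ### Structure of A_{q,n} and criteria for membership in I -/

section

variable {k : Type*} [Field k] {q n : ℕ}

lemma m_pow : m k q n ^ n = ⊥ := by
  rw [m, ← Ideal.map_pow, Ideal.map_quotient_self]

lemma m_eq_span : m k q n = Ideal.span (Set.range (var k q n)) := by
  rw [m]
  exact (Ideal.map_span _ _).trans (by rw [← Set.range_comp]; rfl)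

lemma algHom_ext_var {B : Type*} [Semiring B] [Algebra k B] {f g : A k q n →ₐ[k] B}
    (h : ∀ i, f (var k q n i) = g (var k q n i)) : f = g :=
  Ideal.Quotient.algHom_ext _ (MvPolynomial.algHom_ext h)

/-- The algebra homomorphism on `A_{q,n}` with given values of the variables. -/
noncomputable def lift {B : Type*} [CommRing B] [Algebra k B] {J : Ideal B} (hJ : J ^ n = ⊥)
    (y : Fin q → B)
    (hy : ∀ i, y i ∈ J) : A k q n →ₐ[k] B :=
  Ideal.Quotient.liftₐ _ (MvPolynomial.aeval y) fun a ha => by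
    have h1 : (MvPolynomial.idealOfVars (Fin q) k).map (MvPolynomial.aeval y) ≤ J := by
      refine (Ideal.map_span _ _).trans_le (Ideal.span_le.2 ?_)
      rintro _ ⟨_, ⟨i, rfl⟩, rfl⟩
      simpa using hy i
    have h2 := Ideal.mem_map_of_mem (MvPolynomial.aeval y) ha
    rw [Ideal.map_pow] at h2
    have h3 := Ideal.pow_right_mono h1 n h2
    rw [hJ] at h3
    exact h3

@[simp]
lemma lift_var {B : Type*} [CommRing B] [Algebra k B] {J : Ideal B} (hJ : J ^ n = ⊥)
    (y : Fin q → B) (hy : ∀ i, y i ∈ J) (i : Fin q) : lift hJ y hy (var k q n i) = y i := by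
  rw [lift, var]
  exact (Ideal.Quotient.lift_mk _ _ _).trans (MvPolynomial.aeval_X y i)

lemma exists_algebraMap_sub_mem (a : A k q n) : ∃ c : k, a - algebraMap k _ c ∈ m k q n := by
  obtain ⟨p, rfl⟩ := Ideal.Quotient.mk_surjective a
  refine ⟨p.constantCoeff, ?_⟩
  have : p - MvPolynomial.C p.constantCoeff ∈ MvPolynomial.idealOfVars (Fin q) k := by
    rw [← pow_one (MvPolynomial.idealOfVars (Fin q) k), MvPolynomial.mem_pow_idealOfVars_iff']
    intro x hx
    have : x = 0 := by
      rw [← Finsupp.degree_eq_zero_iff]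
      omega
    simp [this, MvPolynomial.constantCoeff_eq]
  exact Ideal.mem_map_of_mem (Ideal.Quotient.mk _) this

/-- Automorphisms fix constants and A = k + 𝔪, so the condition on 𝔪 extends to all of A. -/
lemma mem_I_iff {g : GA k q n} : g ∈ I k q n ↔ ∀ a, g a - a ∈ m k q n ^ 2 := by
  have h1 : g ∈ I k q n ↔ ∀ a ∈ m k q n, g a - a ∈ m k q n ^ 2 := by
    rw [I, MonoidHom.mem_ker, Units.ext_iff, LinearMap.ext_iff,
      (Ideal.toCotangent_surjective (m k q n)).forall]
    refine ⟨fun h a ha => ?_, fun h a => ?_⟩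
    · exact (Ideal.toCotangent_eq _).1 (h ⟨a, ha⟩)
    · exact (Ideal.toCotangent_eq _).2 (h a a.2)
  rw [h1]
  refine ⟨fun h a => ?_, fun h a _ => h a⟩
  obtain ⟨c, hc⟩ := exists_algebraMap_sub_mem a
  have := h _ hc
  rwa [map_sub, AlgEquiv.commutes, sub_sub_sub_cancel_right] at this

lemma mem_I_of_var {g : GA k q n} (h : ∀ i, g (var k q n i) - var k q n i ∈ m k q n ^ 2) :
    g ∈ I k q n := by
  have hle : m k q n ^ 2 ≤ m k q n := Ideal.pow_le_self two_ne_zero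
  -- A first pass modulo 𝔪 controls the coefficients a in sums of products a·x_i, so that the
  -- product rule then works modulo 𝔪².
  have h0 : ∀ a, g a - a ∈ m k q n := by
    have : (Ideal.Quotient.mkₐ k (m k q n)).comp g.toAlgHom = Ideal.Quotient.mkₐ k (m k q n) :=
      algHom_ext_var fun i => Ideal.Quotient.eq.2 (hle (h i))
    exact fun a => Ideal.Quotient.eq.1 (AlgHom.congr_fun this a)
  have h1 : ∀ a ∈ m k q n, g a - a ∈ m k q n ^ 2 := by
    intro a ha
    rw [m_eq_span] at ha
    induction ha using Submodule.span_induction with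
    | mem x hx => obtain ⟨i, rfl⟩ := hx; exact h i
    | zero => simp
    | add x y _ _ hx hy =>
      rw [map_add, add_sub_add_comm]
      exact Ideal.add_mem _ hx hy
    | smul a x hxs hx =>
      have hxm : x ∈ m k q n := by rw [m_eq_span]; exact hxs
      rw [smul_eq_mul, map_mul,
        show g a * g x - a * x = g a * (g x - x) + (g a - a) * x by ring]
      refine Ideal.add_mem _ (Ideal.mul_mem_left _ _ hx) ?_
      rw [sq]
      exact Ideal.mul_mem_mul (h0 a) hxm
  refine mem_I_iff.2 fun a => ?_
  obtain ⟨c, hc⟩ := exists_algebraMap_sub_mem a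
  have := h1 _ hc
  rwa [map_sub, AlgEquiv.commutes, sub_sub_sub_cancel_right] at this

/-- Every element is a constant plus a nilpotent, hence integral, and the algebra is finitely
generated. -/
instance : Module.Finite k (A k q n) := by
  have hint : Algebra.IsIntegral k (A k q n) := by
    refine ⟨fun a => ?_⟩
    obtain ⟨c, hc⟩ := exists_algebraMap_sub_mem a
    have h : IsIntegral k (a - algebraMap k _ c) :=
      ⟨Polynomial.X ^ n, Polynomial.monic_X_pow n, by simpa using pow_eq_zero_of_mem_m hc⟩
    simpa using h.add (isIntegral_algebraMap (x := c))
  exact Algebra.IsIntegral.finite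

instance : Module.Finite k (TruncPoly k n) :=
  (Polynomial.monic_X_pow n).finite_quotient

end

end NilAut

noncomputable section

namespace NilAut

/-! ### The retraction onto k[z]/z^n with kernel 𝔮₁ -/

section Retraction

variable (k : Type*) [Field k] (q n : ℕ)

/-- The ideal `(z)` of `k[z]/z^n`. -/
def zIdeal : Ideal (TruncPoly k n) := Ideal.span {Ideal.Quotient.mk _ Polynomial.X}

variable {k q n}

lemma zIdeal_pow : zIdeal k n ^ n = ⊥ := by
  rw [zIdeal, Ideal.span_singleton_pow, ← map_pow,
    Ideal.Quotient.eq_zero_iff_mem.2 (Ideal.mem_span_singleton_self _), Ideal.span_singleton_eq_bot]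

lemma mem_zSq_iff {t : TruncPoly k n} : t ∈ zSq k n ↔ t ∈ zIdeal k n ^ 2 := by
  rw [zIdeal, Ideal.span_singleton_pow]
  rfl

lemma truncPoly_algHom_ext {B : Type*} [Semiring B] [Algebra k B] {f g : TruncPoly k n →ₐ[k] B}
    (h : f (Ideal.Quotient.mk _ Polynomial.X) = g (Ideal.Quotient.mk _ Polynomial.X)) : f = g :=
  Ideal.Quotient.algHom_ext _ (Polynomial.algHom_ext h)

variable [NeZero q]

@[simp]
lemma subst_mk (p : Polynomial k) :
    subst k q n (Ideal.Quotient.mk _ p) = Polynomial.aeval (var k q n 0) p := rfl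

variable (k q n) in
/-- The retraction `x_1 ↦ z`, `x_i ↦ 0` of `A_{q,n}` onto `k[z]/z^n`. -/
def retr : A k q n →ₐ[k] TruncPoly k n :=
  lift zIdeal_pow (fun i => if i = 0 then Ideal.Quotient.mk _ Polynomial.X else 0) fun i => by
    split_ifs
    · exact Ideal.mem_span_singleton_self _
    · exact Ideal.zero_mem _

lemma retr_var_zero : retr k q n (var k q n 0) = Ideal.Quotient.mk _ Polynomial.X := by
  simp [retr]

lemma retr_var_of_ne {i : Fin q} (hi : i ≠ 0) : retr k q n (var k q n i) = 0 := by
  simp [retr, hi]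

@[simp]
lemma retr_subst (t : TruncPoly k n) : retr k q n (subst k q n t) = t := by
  have : (retr k q n).comp (subst k q n) = AlgHom.id k _ := truncPoly_algHom_ext <| by
    simp [retr_var_zero]
  exact AlgHom.congr_fun this t

/-- For the converse inclusion, `subst` after `retr` is the identity modulo 𝔮₁, as one checks on the
variables. -/
lemma mem_q₁_iff {a : A k q n} : a ∈ q₁ k q n ↔ retr k q n a = 0 := by
  constructor
  · intro h
    have : q₁ k q n ≤ RingHom.ker (retr k q n) := by
      rw [q₁, Ideal.span_le]
      rintro _ ⟨i, hi, rfl⟩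
      exact retr_var_of_ne hi
    exact this h
  · intro h
    have : ((Ideal.Quotient.mkₐ k (q₁ k q n)).comp (subst k q n)).comp (retr k q n) =
        Ideal.Quotient.mkₐ k (q₁ k q n) := algHom_ext_var fun i => by
      rcases eq_or_ne i 0 with rfl | hi
      · simp [retr_var_zero]
      · simp only [AlgHom.comp_apply, retr_var_of_ne hi, map_zero]
        exact (Ideal.Quotient.eq_zero_iff_mem.2
          (show var k q n i ∈ q₁ k q n from Ideal.subset_span ⟨i, hi, rfl⟩)).symm
    have h' := AlgHom.congr_fun this a
    simp only [AlgHom.comp_apply, h, map_zero] at h'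
    exact Ideal.Quotient.eq_zero_iff_mem.1 h'.symm

lemma Ω₁_le_q₁ {u : A k q n} (hu : u ∈ Ω₁ k q n) : u ∈ q₁ k q n :=
  Submodule.span_le_restrictScalars k (A k q n) _ hu

lemma retr_Ω₁ (u : Ω₁ k q n) : retr k q n u = 0 := mem_q₁_iff.1 (Ω₁_le_q₁ u.2)

lemma retr_mem {a : A k q n} (ha : a ∈ m k q n ^ 2) : retr k q n a ∈ zIdeal k n ^ 2 := by
  have h : (m k q n).map (retr k q n) ≤ zIdeal k n := by
    rw [m_eq_span, Ideal.map_span, Ideal.span_le]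
    rintro _ ⟨_, ⟨i, rfl⟩, rfl⟩
    rcases eq_or_ne i 0 with rfl | hi
    · rw [retr_var_zero]
      exact Ideal.mem_span_singleton_self _
    · rw [retr_var_of_ne hi]
      exact Ideal.zero_mem _
  have := Ideal.mem_map_of_mem (retr k q n) ha
  rw [Ideal.map_pow] at this
  exact Ideal.pow_right_mono h 2 this

lemma subst_mem {t : TruncPoly k n} (ht : t ∈ zIdeal k n ^ 2) :
    subst k q n t ∈ m k q n ^ 2 := by
  have h : (zIdeal k n).map (subst k q n) ≤ m k q n := by
    rw [zIdeal, Ideal.map_span, Ideal.span_le]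
    rintro _ ⟨_, rfl, rfl⟩
    simpa using var_mem_m 0
  have := Ideal.mem_map_of_mem (subst k q n) ht
  rw [Ideal.map_pow] at this
  exact Ideal.pow_right_mono h 2 this

end Retraction

/-! ### Shears, and their identification with Γ -/

section Shear

variable {k : Type*} [Field k] {q n : ℕ} [NeZero q]

variable (k q n) in
/-- The variable `x_i` as an element of `Ω₁`, replaced by `0` for `x_1`. -/
def varΩ₁ (i : Fin q) : Ω₁ k q n :=
  if hi : i = 0 then 0 else ⟨var k q n i, Submodule.subset_span ⟨i, hi, rfl⟩⟩

lemma varΩ₁_zero : varΩ₁ k q n 0 = 0 := by simp [varΩ₁]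

lemma coe_varΩ₁ {i : Fin q} (hi : i ≠ 0) : (varΩ₁ k q n i : A k q n) = var k q n i := by
  simp [varΩ₁, hi]

lemma subst_hom_mem (h : HomSpace k q n) (u : Ω₁ k q n) :
    subst k q n (h u) ∈ m k q n ^ 2 :=
  subst_mem (mem_zSq_iff.1 (h u).2)

/-- The endomorphism `x_1 ↦ x_1`, `x_i ↦ x_i + h(x_i)(x_1)` of `A_{q,n}`. -/
def shearHom (h : HomSpace k q n) : A k q n →ₐ[k] A k q n :=
  lift m_pow (fun i => var k q n i + subst k q n (h (varΩ₁ k q n i))) fun i =>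
    Ideal.add_mem _ (var_mem_m i) (Ideal.pow_le_self two_ne_zero (subst_hom_mem h _))

lemma shearHom_var (h : HomSpace k q n) (i : Fin q) :
    shearHom h (var k q n i) = var k q n i + subst k q n (h (varΩ₁ k q n i)) := by
  simp [shearHom]

@[simp]
lemma shearHom_subst (h : HomSpace k q n) (t : TruncPoly k n) :
    shearHom h (subst k q n t) = subst k q n t := by
  have : (shearHom h).comp (subst k q n) = subst k q n := truncPoly_algHom_ext <| by
    simp [shearHom_var, varΩ₁_zero]
  exact AlgHom.congr_fun this t

/-- The correction terms are polynomials in x_1, which every shear fixes, so they simply add. -/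
lemma shearHom_comp (h h' : HomSpace k q n) :
    (shearHom h).comp (shearHom h') = shearHom (h + h') := algHom_ext_var fun i => by
  simp [shearHom_var, add_assoc]

lemma shearHom_zero : shearHom (0 : HomSpace k q n) = AlgHom.id k _ := algHom_ext_var fun i => by
  simp [shearHom_var]

/-- The automorphism `x_1 ↦ x_1`, `x_i ↦ x_i + h(x_i)(x_1)` of `A_{q,n}`. -/
def shear (h : HomSpace k q n) : GA k q n :=
  AlgEquiv.ofAlgHom (shearHom h) (shearHom (-h))
    (by rw [shearHom_comp, show h + -h = 0 from add_neg_cancel h, shearHom_zero])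
    (by rw [shearHom_comp, show -h + h = 0 from neg_add_cancel h, shearHom_zero])

lemma shear_apply (h : HomSpace k q n) (a : A k q n) : shear h a = shearHom h a := rfl

lemma shear_mul (h h' : HomSpace k q n) : shear h * shear h' = shear (h + h') :=
  AlgEquiv.ext fun a => AlgHom.congr_fun (shearHom_comp h h') a

lemma shear_inv (h : HomSpace k q n) : (shear h)⁻¹ = shear (-h) := by
  rw [inv_eq_iff_mul_eq_one, shear_mul, show h + -h = 0 from add_neg_cancel h]
  exact AlgEquiv.ext fun a => AlgHom.congr_fun shearHom_zero a

lemma eq_of_eq_on_varΩ₁ {B : Type*} [AddCommGroup B] [Module k B] {f g : Ω₁ k q n →ₗ[k] B}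
    (h : ∀ i ≠ 0, f (varΩ₁ k q n i) = g (varΩ₁ k q n i)) : f = g := by
  ext ⟨u, hu⟩
  induction hu using Submodule.span_induction with
  | mem x hx =>
    obtain ⟨i, hi, rfl⟩ := hx
    have := h i hi
    rwa [show varΩ₁ k q n i = ⟨var k q n i, Submodule.subset_span ⟨i, hi, rfl⟩⟩ from
      Subtype.ext (coe_varΩ₁ hi)] at this
  | zero => exact (map_zero f).trans (map_zero g).symm
  | add x y hx hy h1 h2 =>
    have := congrArg₂ (· + ·) h1 h2
    simp only [← map_add] at this
    exact this
  | smul c x hx h1 =>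
    have := congrArg (c • ·) h1
    simp only [← map_smul] at this
    exact this

lemma shear_Ω₁ (h : HomSpace k q n) (u : Ω₁ k q n) :
    shear h (u : A k q n) = u + subst k q n (h u) := by
  have : (shearHom h).toLinearMap ∘ₗ (Ω₁ k q n).subtype =
      (Ω₁ k q n).subtype + (subst k q n).toLinearMap ∘ₗ (zSq k n).subtype ∘ₗ h :=
    eq_of_eq_on_varΩ₁ fun i hi => by
      simp [coe_varΩ₁ hi, shearHom_var]
  exact LinearMap.congr_fun this u

lemma shear_mem_I (h : HomSpace k q n) : shear h ∈ I k q n := mem_I_of_var fun i => by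
  rw [shear_apply, shearHom_var, add_sub_cancel_left]
  exact subst_hom_mem h _

lemma shear_mem_Γ (h : HomSpace k q n) : shear h ∈ Γ k q n := by
  refine ⟨by simp [shear_apply, shearHom_var, varΩ₁_zero], fun i _ => ?_⟩
  obtain ⟨t, ht⟩ := Ideal.mem_span_singleton.1 (h (varΩ₁ k q n i)).2
  obtain ⟨f, rfl⟩ := Ideal.Quotient.mk_surjective t
  refine ⟨f, ?_⟩
  rw [shear_apply, shearHom_var, ht]
  simp

lemma exists_shear_eq {σ : GA k q n} (hσ : σ ∈ Γ k q n) : ∃ h : HomSpace k q n, shear h = σ := by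
  obtain ⟨h0, h1⟩ := hσ
  -- The map is read off from σ by ρ instead of being prescribed on the variables, which are not
  -- linearly independent when n = 1.
  let L : Ω₁ k q n →ₗ[k] TruncPoly k n :=
    (retr k q n).toLinearMap ∘ₗ σ.toLinearMap ∘ₗ (Ω₁ k q n).subtype
  have hL : ∀ u, L u ∈ zSq k n := by
    have : (zSq k n).mkQ ∘ₗ L = 0 := eq_of_eq_on_varΩ₁ fun i hi => by
      obtain ⟨f, hf⟩ := h1 i hi
      have : L (varΩ₁ k q n i) ∈ zSq k n := by
        change retr k q n (σ (varΩ₁ k q n i : A k q n)) ∈ zSq k n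
        rw [coe_varΩ₁ hi, hf, map_add, retr_var_of_ne hi, zero_add, map_mul, map_pow,
          retr_var_zero]
        exact Ideal.mul_mem_right _ _ (Ideal.mem_span_singleton_self _)
      simpa using this
    intro u
    simpa using LinearMap.congr_fun this u
  refine ⟨L.codRestrict _ hL, AlgEquiv.ext fun a => ?_⟩
  have : shearHom (L.codRestrict _ hL) = σ.toAlgHom := algHom_ext_var fun i => by
    rcases eq_or_ne i 0 with rfl | hi
    · simp [shearHom_var, varΩ₁_zero, h0]
    · obtain ⟨f, hf⟩ := h1 i hi
      have h2 : L (varΩ₁ k q n i) = Ideal.Quotient.mk _ (Polynomial.X ^ 2 * f) := by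
        change retr k q n (σ (varΩ₁ k q n i : A k q n)) = _
        rw [coe_varΩ₁ hi, hf, ← retr_subst (q := q) (Ideal.Quotient.mk _ (Polynomial.X ^ 2 * f)),
          map_add, retr_var_of_ne hi, zero_add]
        simp
      rw [shearHom_var]
      simp [h2, hf]
  exact AlgHom.congr_fun this a

lemma retr_apply_eq_zero {g : GA k q n} (hg : g ∈ G₁ k q n) {a : A k q n} (ha : a ∈ q₁ k q n) :
    retr k q n (g a) = 0 := by
  have hg' : (q₁ k q n).map (g : A k q n →+* A k q n) = q₁ k q n := hg
  rw [← mem_q₁_iff, ← hg']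
  exact Ideal.mem_map_of_mem (g : A k q n →+* A k q n) ha

/-- Applying ρ to u + h(u)(x_1), which must lie in 𝔮₁, returns h(u). -/
lemma eq_zero_of_shear_mem_G₁ {h : HomSpace k q n} (hh : shear h ∈ G₁ k q n) : h = 0 := by
  ext u : 2
  have := retr_apply_eq_zero hh (Ω₁_le_q₁ u.2)
  rw [shear_Ω₁, map_add, retr_Ω₁, zero_add, retr_subst] at this
  simpa using this

lemma eq_of_shear_mul_eq {h h' : HomSpace k q n} {τ τ' : GA k q n} (hτ : τ ∈ G₁ k q n)
    (hτ' : τ' ∈ G₁ k q n) (H : shear h * τ = shear h' * τ') : h = h' := by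
  have h1 : shear (-h' + h) = τ' * τ⁻¹ := by
    rw [← shear_mul, ← shear_inv, inv_mul_eq_iff_eq_mul, ← mul_assoc, ← H, mul_inv_cancel_right]
  have h2 := eq_zero_of_shear_mem_G₁ (h1 ▸ mul_mem hτ' (inv_mem hτ))
  exact (neg_add_eq_zero.1 h2).symm

/-- Here τ induces φ on A/𝔮₁ = k[z]/z^n; injectivity of φ yields the inclusion of 𝔮₁ in τ(𝔮₁). -/
lemma mem_G₁_of_retr {τ : GA k q n} (φ : TruncPoly k n ≃ₐ[k] TruncPoly k n)
    (h : ∀ a, retr k q n (τ a) = φ (retr k q n a)) : τ ∈ G₁ k q n := by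
  change (q₁ k q n).map (τ : A k q n →+* A k q n) = q₁ k q n
  refine le_antisymm (Ideal.map_le_iff_le_comap.2 fun a ha => ?_) fun a ha => ?_
  · rw [Ideal.mem_comap, mem_q₁_iff]
    exact (h a).trans (by rw [mem_q₁_iff.1 ha, map_zero])
  · have h1 : τ.symm a ∈ q₁ k q n := by
      have := h (τ.symm a)
      rw [AlgEquiv.apply_symm_apply, mem_q₁_iff.1 ha] at this
      rw [mem_q₁_iff]
      simpa using this.symm
    have := Ideal.mem_map_of_mem (τ : A k q n →+* A k q n) h1
    simpa using this

end Shear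

/-! ### The coordinate h of a coset, and its algebraicity -/

section Coordinate

variable {k : Type*} [Field k] {q n : ℕ} [NeZero q]

omit [NeZero q] in
lemma symm_sub_mem (g : I k q n) (a : A k q n) :
    (g : GA k q n).symm a - a ∈ m k q n ^ 2 :=
  mem_I_iff.1 (inv_mem g.2) a

lemma retr_symm_subst_sub_mem (g : I k q n) (t : TruncPoly k n) :
    ((retr k q n).comp ((g : GA k q n).symm.toAlgHom.comp (subst k q n))) t - t
      ∈ zIdeal k n ^ 2 := by
  have := retr_mem (symm_sub_mem g (subst k q n t))
  rw [map_sub, retr_subst] at this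
  exact this

/-- The automorphism `z ↦ ρ(g⁻¹(x_1))` of `k[z]/z^n`, where `ρ` is the retraction. -/
def reparam (g : I k q n) : TruncPoly k n ≃ₐ[k] TruncPoly k n :=
  AlgEquiv.ofBijective ((retr k q n).comp ((g : GA k q n).symm.toAlgHom.comp (subst k q n)))
    (bijective_of_map_sub_self_mem zIdeal_pow (retr_symm_subst_sub_mem g))

lemma reparam_apply (g : I k q n) (t : TruncPoly k n) :
    reparam g t = retr k q n ((g : GA k q n).symm (subst k q n t)) := rfl

/-- The homomorphism `u ↦ -φ⁻¹(ρ(g⁻¹(u)))` with values in `k[z]/z^n`, where `φ = reparam g`. -/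
def coordAux (g : I k q n) : Ω₁ k q n →ₗ[k] TruncPoly k n :=
  -((reparam g).symm.toLinearMap ∘ₗ (retr k q n).toLinearMap ∘ₗ
    (g : GA k q n).symm.toLinearMap ∘ₗ (Ω₁ k q n).subtype)

lemma coordAux_mem (g : I k q n) (u : Ω₁ k q n) : coordAux g u ∈ zSq k n := by
  refine neg_mem (mem_zSq_iff.2 ?_)
  change (reparam g).symm (retr k q n ((g : GA k q n).symm u)) ∈ _
  set t := retr k q n ((g : GA k q n).symm u) with ht
  have h1 : t ∈ zIdeal k n ^ 2 := by
    have := retr_mem (symm_sub_mem g u)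
    rwa [map_sub, retr_Ω₁, sub_zero] at this
  -- With φ = `reparam g` and s = φ⁻¹(t), both φ(s) = t and φ(s) - s lie in (z²), hence so does s.
  have h2 : reparam g ((reparam g).symm t) - (reparam g).symm t ∈ zIdeal k n ^ 2 :=
    retr_symm_subst_sub_mem g ((reparam g).symm t)
  rw [AlgEquiv.apply_symm_apply] at h2
  simpa using Ideal.sub_mem _ h1 h2

/-- The homomorphism `h` with `g ∈ shear h * G₁`. -/
def coord (g : I k q n) : HomSpace k q n := (coordAux g).codRestrict _ (coordAux_mem g)

lemma coe_coord (g : I k q n) (u : Ω₁ k q n) : (coord g u : TruncPoly k n) = coordAux g u := rfl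

lemma shear_coord_inv_mul_mem (g : I k q n) :
    (shear (coord g))⁻¹ * g ∈ I k q n ⊓ G₁ k q n := by
  refine ⟨(I k q n).mul_mem ((I k q n).inv_mem (shear_mem_I _)) g.2, ?_⟩
  change (shear (coord g))⁻¹ * (g : GA k q n) ∈ G₁ k q n
  -- Passing to the inverse g⁻¹ ∘ shear(h) allows comparison with ρ ∘ g⁻¹, from which h was built.
  -- On x_i with i ≠ 0 the required identity is the defining equation of h.
  rw [← inv_mem_iff, mul_inv_rev, inv_inv]
  refine mem_G₁_of_retr (reparam g) ?_
  have : ((retr k q n).comp (g : GA k q n).symm.toAlgHom).comp (shearHom (coord g)) =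
      (reparam g).toAlgHom.comp (retr k q n) := algHom_ext_var fun i => by
    change retr k q n ((g : GA k q n).symm (shearHom (coord g) (var k q n i))) =
      reparam g (retr k q n (var k q n i))
    rw [shearHom_var, map_add, map_add, ← reparam_apply]
    rcases eq_or_ne i 0 with rfl | hi
    · rw [varΩ₁_zero, map_zero, retr_var_zero, reparam_apply, reparam_apply, subst_mk,
        Polynomial.aeval_X]
      simp
    · rw [retr_var_of_ne hi, map_zero, coe_coord]
      have h1 : coordAux g (varΩ₁ k q n i) =
          -(reparam g).symm (retr k q n ((g : GA k q n).symm (varΩ₁ k q n i : A k q n))) := rfl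
      rw [h1, coe_varΩ₁ hi, map_neg, AlgEquiv.apply_symm_apply, add_neg_cancel]
  exact AlgHom.congr_fun this

lemma coord_eq_of_shear_mul {g : I k q n} {h : HomSpace k q n} {τ : GA k q n}
    (hτ : τ ∈ G₁ k q n) (H : shear h * τ = g) : coord g = h :=
  (eq_of_shear_mul_eq hτ (shear_coord_inv_mul_mem g).2 (by rw [H, mul_inv_cancel_left])).symm

lemma coord_shear (h : HomSpace k q n) : coord ⟨shear h, shear_mem_I h⟩ = h :=
  coord_eq_of_shear_mul (one_mem _) (mul_one _)

lemma coord_eq_iff (g g' : I k q n) : coord g = coord g' ↔ (g : Quot₁ k q n) = g' := by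
  rw [QuotientGroup.eq, Subgroup.mem_subgroupOf]
  constructor
  · intro h
    have := mul_mem (inv_mem (shear_coord_inv_mul_mem g)) (shear_coord_inv_mul_mem g')
    rw [h] at this
    simpa [mul_assoc] using this
  · intro h
    symm
    refine coord_eq_of_shear_mul (mul_mem (shear_coord_inv_mul_mem g).2 h.2) ?_
    simp [mul_assoc]

variable (k q n) in
/-- The bijection of `I/(I ∩ G₁)` with `Hom_k(Ω₁, z² k[z]/z^n)`. -/
def quotEquiv : Quot₁ k q n ≃ HomSpace k q n where
  toFun := Quotient.lift coord fun g g' h => (coord_eq_iff g g').2 (Quotient.sound h)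
  invFun h := ((⟨shear h, shear_mem_I h⟩ : I k q n) : Quot₁ k q n)
  left_inv := by
    intro x
    obtain ⟨g, rfl⟩ := QuotientGroup.mk_surjective x
    exact (coord_eq_iff _ _).1 (coord_shear _)
  right_inv := coord_shear

lemma quotEquiv_mk (g : I k q n) : quotEquiv k q n (g : Quot₁ k q n) = coord g := rfl

/-- The image of each variable is affine-linear in h, and sums and products of polynomial maps are
polynomial. -/
lemma isPolyMap_shear :
    IsPolyMap k (fun h : HomSpace k q n => ((shear h).toLinearMap : Module.End k (A k q n))) := by
  refine IsPolyMap.of_apply fun a => ?_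
  obtain ⟨p, rfl⟩ := Ideal.Quotient.mk_surjective a
  change IsPolyMap k fun h : HomSpace k q n => shearHom h (Ideal.Quotient.mk _ p)
  induction p using MvPolynomial.induction_on with
  | C c =>
    have : ∀ h : HomSpace k q n, shearHom h (Ideal.Quotient.mk _ (MvPolynomial.C c)) =
      algebraMap k _ c := fun h => (shearHom h).commutes c
    simp only [this]
    exact IsPolyMap.const _
  | add p p' hp hp' =>
    simp only [map_add]
    exact hp.add hp'
  | mul_X p i hp =>
    simp only [map_mul]
    refine hp.mul ?_
    have : ∀ h : HomSpace k q n, shearHom h (Ideal.Quotient.mk _ (MvPolynomial.X i)) =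
      var k q n i + subst k q n (h (varΩ₁ k q n i)) := fun h => shearHom_var h i
    simp only [this]
    let L : HomSpace k q n →ₗ[k] A k q n :=
      { toFun := fun h => subst k q n (h (varΩ₁ k q n i))
        map_add' := fun h h' => map_add (subst k q n) (h _ : TruncPoly k n) (h' _)
        map_smul' := fun c h => map_smul (subst k q n) c (h _ : TruncPoly k n) }
    have hL : IsPolyMap k L := IsPolyMap.linear (V := HomSpace k q n) (W := A k q n) L
    exact (IsPolyMap.const (V := HomSpace k q n) (W := A k q n) (var k q n i)).add hL

lemma exists_isPolyMap_coord : ∃ F : Module.End k (A k q n) → HomSpace k q n,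
    IsPolyMap k F ∧ ∀ g : I k q n, coord g = F (I.toEnd k q n g) := by
  -- For an arbitrary endomorphism M of A the formula need not take values in z²k[z]/z^n. The linear
  -- projection r forces this and changes nothing on I.
  obtain ⟨r, hr⟩ := (zSq k n).subtype.exists_leftInverse_of_injective (zSq k n).ker_subtype
  refine ⟨_, IsPolyMap.compressed_inverse (retr k q n).toLinearMap (subst k q n).toLinearMap
    (Ω₁ k q n).subtype (-r) n, fun g => ?_⟩
  have inv_eq : ∑ b ∈ Finset.range n, (1 - I.toEnd k q n g) ^ b =
      (g : GA k q n).symm.toLinearMap :=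
    (symm_toLinearMap_eq_geom_sum m_pow (mem_I_iff.1 g.2)).symm
  have φ_eq := symm_toLinearMap_eq_geom_sum zIdeal_pow (φ := reparam g)
    (fun t => retr_symm_subst_sub_mem g t)
  have h1 : coord g = r ∘ₗ coordAux g :=
    LinearMap.ext fun u => (LinearMap.congr_fun hr (coord g u)).symm
  rw [inv_eq, h1]
  have h2 : (reparam g).toLinearMap = (retr k q n).toLinearMap ∘ₗ
    (g : GA k q n).symm.toLinearMap ∘ₗ (subst k q n).toLinearMap := rfl
  rw [← h2, ← φ_eq, coordAux, LinearMap.comp_neg, LinearMap.neg_comp]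

/-- Openness and regularity on the quotient are tested on I. The map is therefore a morphism because
`coord` is one, and its inverse because it lifts to the morphism h ↦ `shear h` into I. -/
lemma isIsomorphism_quotEquiv : IsIsomorphism (Quot₁.variety k q n)
    (affineSpace k (HomSpace k q n)) (quotEquiv k q n) := by
  obtain ⟨F, hF, hF'⟩ := exists_isPolyMap_coord (k := k) (q := q) (n := n)
  have h1 : IsMorphism (I.variety k q n) (affineSpace k (HomSpace k q n)) coord :=
    hF.isMorphism hF'
  have h2 : IsMorphism (affineSpace k (HomSpace k q n)) (I.variety k q n)
      (fun h => ⟨shear h, shear_mem_I h⟩) := isPolyMap_shear.isMorphism fun h => rfl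
  exact ⟨⟨fun U hU => h1.isOpen_preimage U hU, fun U f hU hf => h1.regularOn_comp U f hU hf⟩,
    ⟨fun U hU => h2.isOpen_preimage _ hU, fun U f hU hf => h2.regularOn_comp _ _ hU hf⟩⟩

/-- The factor τ preserves 𝔮₁, so only the shear matters, and Ω₁ generates 𝔮₁. -/
lemma map_q₁_eq_span (g : I k q n) :
    (q₁ k q n).map ((g : GA k q n) : A k q n →+* A k q n) =
      Ideal.span (Set.range fun u : Ω₁ k q n => (u : A k q n) + subst k q n (coord g u)) := by
  have hτ : (q₁ k q n).map ((((shear (coord g))⁻¹ * g : GA k q n)) : A k q n →+* A k q n) =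
    q₁ k q n := (shear_coord_inv_mul_mem g).2
  have hg : ((g : GA k q n) : A k q n →+* A k q n) =
      ((shear (coord g) : GA k q n) : A k q n →+* A k q n).comp
        (((shear (coord g))⁻¹ * g : GA k q n) : A k q n →+* A k q n) :=
    RingHom.ext fun a => ((shear (coord g)).apply_symm_apply _).symm
  have hq : q₁ k q n = Ideal.span (Ω₁ k q n : Set (A k q n)) :=
    (Submodule.span_span_of_tower k (A k q n) _).symm
  rw [hg, ← Ideal.map_map, hτ, hq, Ideal.map_span]
  congr 1
  ext a
  constructor
  · rintro ⟨u, hu, rfl⟩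
    exact ⟨⟨u, hu⟩, (shear_Ω₁ (coord g) ⟨u, hu⟩).symm⟩
  · rintro ⟨u, rfl⟩
    exact ⟨u, u.2, shear_Ω₁ (coord g) u⟩

end Coordinate

/-! ### Dimension of the target -/

section Rank

variable {k : Type*} [Field k] {q n : ℕ}

/-- For n ≥ 2 the n-th power of the ideal of the variables contains no nonzero linear form, so
degree-one coefficients can be compared. -/
lemma linearIndependent_var (hn : 2 ≤ n) : LinearIndependent k (var k q n) := by
  rw [Fintype.linearIndependent_iff]
  intro c hc i
  have h : (Ideal.Quotient.mk _ (∑ j, MvPolynomial.C (c j) * MvPolynomial.X j) : A k q n) = 0 := by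
    rw [← hc, map_sum]
    refine Finset.sum_congr rfl fun j _ => ?_
    rw [map_mul]
    exact (Algebra.smul_def (c j) (var k q n j)).symm
  rw [Ideal.Quotient.eq_zero_iff_mem, MvPolynomial.mem_pow_idealOfVars_iff'] at h
  have := h (Finsupp.single i 1) (by simp; omega)
  simpa [MvPolynomial.coeff_sum, MvPolynomial.coeff_C_mul, MvPolynomial.coeff_X,
    Finsupp.single_left_inj] using this

lemma finrank_Ω₁ [NeZero q] (hn : 2 ≤ n) : Module.finrank k (Ω₁ k q n) = q - 1 := by
  have h : Ω₁ k q n =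
      Submodule.span k (Set.range fun i : {i : Fin q // i ≠ 0} => var k q n i) := by
    rw [Ω₁]
    congr 1
    ext a
    constructor
    · rintro ⟨i, hi, rfl⟩
      exact ⟨⟨i, hi⟩, rfl⟩
    · rintro ⟨⟨i, hi⟩, rfl⟩
      exact ⟨i, hi, rfl⟩
  have hli : LinearIndependent k fun i : {i : Fin q // i ≠ 0} => var k q n i :=
    (linearIndependent_var hn).comp _ Subtype.val_injective
  rw [h, finrank_span_eq_card hli]
  simp [Fintype.card_subtype_compl]

lemma finrank_truncPoly : Module.finrank k (TruncPoly k n) = n := by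
  rw [finrank_quotient_span_eq_natDegree, Polynomial.natDegree_X_pow]

/-- Rank-nullity for the surjection k[z]/z^n → k[z]/z², whose kernel is this space. -/
lemma finrank_zSq (hn : 2 ≤ n) : Module.finrank k (zSq k n) = n - 2 := by
  have hle : Ideal.span {(Polynomial.X : Polynomial k) ^ n} ≤ Ideal.span {Polynomial.X ^ 2} :=
    Ideal.span_singleton_le_span_singleton.2 (pow_dvd_pow _ hn)
  let f : TruncPoly k n →ₐ[k] TruncPoly k 2 := Ideal.Quotient.factorₐ k hle
  have hf : Function.Surjective f := Ideal.Quotient.factor_surjective hle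
  have hker : LinearMap.ker f.toLinearMap = zSq k n := by
    ext t
    obtain ⟨p, rfl⟩ := Ideal.Quotient.mk_surjective t
    change Ideal.Quotient.mk _ p = 0 ↔ Ideal.Quotient.mk _ p ∈ Ideal.span _
    rw [Ideal.Quotient.eq_zero_iff_mem, ← map_pow,
      ← Set.image_singleton (f := Ideal.Quotient.mk _), ← Ideal.map_span,
      Ideal.mem_quotient_iff_mem hle]
  have h := f.toLinearMap.finrank_range_add_finrank_ker
  rw [LinearMap.range_eq_top.2 hf, finrank_top, hker, finrank_truncPoly, finrank_truncPoly] at h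
  omega

lemma rank_homSpace [NeZero q] (hn : 2 ≤ n) :
    Module.rank k (HomSpace k q n) = (((q - 1) * (n - 2) : ℕ) : Cardinal) := by
  rw [← Module.finrank_eq_rank, Module.finrank_linearMap, finrank_Ω₁ hn, finrank_zSq hn]

end Rank

end NilAut

end

theorem corollary4p4 (k : Type*) [Field k] [IsAlgClosed k] (q n : ℕ) [NeZero q] (hn : 1 ≤ n) :
    (∃ ψ : NilAut.Quot₁ k q n ≃ NilAut.HomSpace k q n,
      -- `ψ` is an isomorphism of varieties
      NilAut.IsIsomorphism (NilAut.Quot₁.variety k q n)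
        (NilAut.affineSpace k (NilAut.HomSpace k q n)) ψ ∧
      -- `ψ` is induced by the projection of `Γ × (I ∩ G₁) ≃ I` to `Γ ≃ Hom_k(Ω₁, z² k[z]/z^n)`
      (∀ g : NilAut.I k q n,
        (∃! p : NilAut.GA k q n × NilAut.GA k q n, p.1 ∈ NilAut.Γ k q n ∧
          p.2 ∈ NilAut.I k q n ⊓ NilAut.G₁ k q n ∧ p.1 * p.2 = g) ∧
        ∀ σ ∈ NilAut.Γ k q n, ∀ τ ∈ NilAut.I k q n ⊓ NilAut.G₁ k q n, σ * τ = g →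
          ∀ u : NilAut.Ω₁ k q n,
            σ (u : NilAut.A k q n) = u + NilAut.subst k q n (ψ (g : NilAut.Quot₁ k q n) u)) ∧
      -- in terms of the ideals in the orbit of `𝔮₁`
      (∀ g : NilAut.I k q n,
        (NilAut.q₁ k q n).map ((g : NilAut.GA k q n) : NilAut.A k q n →+* NilAut.A k q n) =
          Ideal.span (Set.range fun u : NilAut.Ω₁ k q n =>
            (u : NilAut.A k q n) + NilAut.subst k q n (ψ (g : NilAut.Quot₁ k q n) u)))) ∧
    -- the target is an affine space of dimension `(q - 1)(n - 2)`
    (2 ≤ n → Module.rank k (NilAut.HomSpace k q n) = (((q - 1) * (n - 2) : ℕ) : Cardinal)) := by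
  refine ⟨⟨NilAut.quotEquiv k q n, NilAut.isIsomorphism_quotEquiv, fun g => ⟨?_, ?_⟩,
    NilAut.map_q₁_eq_span⟩, NilAut.rank_homSpace⟩
  · refine ⟨⟨NilAut.shear (NilAut.coord g), (NilAut.shear (NilAut.coord g))⁻¹ * g⟩,
      ⟨NilAut.shear_mem_Γ _, NilAut.shear_coord_inv_mul_mem g, mul_inv_cancel_left _ _⟩, ?_⟩
    rintro ⟨σ, τ⟩ ⟨hσ, hτ, H⟩
    obtain ⟨h, rfl⟩ := NilAut.exists_shear_eq hσ
    rw [NilAut.coord_eq_of_shear_mul hτ.2 H]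
    exact Prod.ext rfl (eq_inv_mul_of_mul_eq H)
  · intro σ hσ τ hτ H u
    obtain ⟨h, rfl⟩ := NilAut.exists_shear_eq hσ
    rw [NilAut.quotEquiv_mk, NilAut.coord_eq_of_shear_mul hτ.2 H]
    exact NilAut.shear_Ω₁ h u
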